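/- **Setting.** A quantum state on a $d$-dimensional Hilbert space is a positive semidefinite $d\times d$ complex matrix of trace one. For states $\rho,\sigma$ let $F(\rho,\sigma)=\|\sqrt\rho\sqrt\sigma\|_1$ with $\|A\|_1=\operatorname{tr}\sqrt{A^\dagger A}$. For sets $\mathcal D_1,\mathcal D_2$ of states, $p\in(0,1)$, and $n\ge 1$, let $$P_{e,\min}(p,\mathcal D_{1,n},\mathcal D_{2,n})=\inf_{0\preceq\Pi\preceq I}\ \sup_{\rho_1\in\mathcal D_1,\ \rho_2\in\mathcal D_2}\Bigl(p\operatorname{tr}\bigl((I-\Pi)\rho_1^{\otimes n}\bigr)+(1-p)\operatorname{tr}\bigl(\Pi\rho_2^{\otimes n}\bigr)\Bigr),$$ and for $\delta\in(0,1)$ let the sample complexity be $n^\ast(\delta)=\inf\{n\ge 1: P_{e,\min}(p,\mathcal D_{1,n},\mathcal D_{2,n})\le\delta\}\in\{1,2,\dots\}\cup\{+\infty\}$. Put $F_{\max}=\sup_{\rho_1\in\mathcal D_1,\rho_2\in\mathcal D_2}F(\rho_1,\rho_2)$. Call $(\mathcal D_1,\mathcal D_2)$ *admissible* if $|\mathcal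 D_i|=m_i<\infty$ for $i=1,2$, $\mathcal D_1\cap\mathcal D_2=\emptyset$, and $\rho_1\rho_2\ne 0$ for some $\rho_1\in\mathcal D_1$, $\rho_2\in\mathcal D_2$. **Theorem.** Let $p\in(0,1)$. 1. For every $d$, every admissible pair $(\mathcal D_1,\mathcal D_2)$ of sets of states in dimension $d$ and every $\delta\in(0,1)$: if $\delta<\sqrt{m_1m_2p(1-p)}$, then $$n^\ast(\delta)\le\left\lceil\frac{\ln\bigl(\sqrt{m_1m_2p(1-p)}/\delta\bigr)}{-\ln F_{\max}}\right\rceil ,$$ and if $\delta\ge\sqrt{m_1m_2p(1-p)}$, then $n^\ast(\delta)=1$. 2. ($\Omega\bigl(\ln(1/\delta)/(-\ln F_{\max})\bigr)\le n^\ast(\delta)$.) For every $\delta_0$ with $0<\delta_0<\min\{p,1-p\}$ there is a constant $c>0$, depending only on $p$ and $\delta_0$, such that for every $d$, every admissible pair in dimension $d$ and every $\delta\in(0,\delta_0]$, $$c\,\frac{\ln(1/\delta)}{-\ln F_{\max}}\le n^\ast(\delta).$$ 3. ($n^\ast(\delta)\le\mathcal O\bigl(\ln(\sqrt{m_1m_2}/\delta)/(-\ln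 F_{\max})\bigr)$.) There is a constant $C>0$, depending only on $p$, such that for every $d$, every admissible pair in dimension $d$ and every $\delta\in(0,1)$ with $\delta\le\sqrt{m_1m_2}\,F_{\max}$ (equivalently, $\ln(\sqrt{m_1m_2}/\delta)/(-\ln F_{\max})\ge 1$), $$n^\ast(\delta)\le C\,\frac{\ln(\sqrt{m_1m_2}/\delta)}{-\ln F_{\max}}.$$ -/

import Mathlib

open scoped Matrix ComplexOrder MatrixOrder

noncomputable section

namespace QHT

/-- Quantum states on a `d`-dimensional Hilbert space: positive semidefinite matrices of
trace one. -/
abbrev DensityMatrix (d : ℕ) : Type :=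
  {ρ : Matrix (Fin d) (Fin d) ℂ // ρ.PosSemidef ∧ ρ.trace = 1}

/-- The trace norm `‖A‖₁ = tr √(A† A)`. -/
def traceNorm {ι : Type*} [Fintype ι] [DecidableEq ι] (A : Matrix ι ι ℂ) : ℝ :=
  (CFC.sqrt (Aᴴ * A)).trace.re

/-- The (square root) Uhlmann fidelity `F(ρ, σ) = ‖√ρ √σ‖₁`. -/
def fidelity {d : ℕ} (ρ σ : DensityMatrix d) : ℝ :=
  traceNorm (CFC.sqrt ρ.1 * CFC.sqrt σ.1)

/-- The maximal fidelity `F_max = sup {F(ρ₁, ρ₂) : ρ₁ ∈ D₁, ρ₂ ∈ D₂}`. -/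
def maxFidelity {d : ℕ} (D₁ D₂ : Set (DensityMatrix d)) : ℝ :=
  sSup (Set.image2 fidelity D₁ D₂)

/-- Orthogonality of two sets of states: `ρ₁ ρ₂ = 0` for all `ρ₁ ∈ D₁`, `ρ₂ ∈ D₂`. -/
def Orthogonal {d : ℕ} (D₁ D₂ : Set (DensityMatrix d)) : Prop :=
  ∀ ρ₁ ∈ D₁, ∀ ρ₂ ∈ D₂, ρ₁.1 * ρ₂.1 = 0

/-- The `n`-fold tensor power of a matrix acting on `ℂ^d`, as a matrix acting on `(ℂ^d)^{⊗ n}`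
in the product basis, which is indexed by `Fin n → Fin d`. -/
def tensorPower {d : ℕ} (n : ℕ) (A : Matrix (Fin d) (Fin d) ℂ) :
    Matrix (Fin n → Fin d) (Fin n → Fin d) ℂ :=
  Matrix.of fun i j => ∏ k, A (i k) (j k)

/-- The tests `Π` with `0 ≤ Π ≤ I`, i.e. the two-outcome POVMs `{Π, I - Π}`. -/
def tests (ι : Type*) [Fintype ι] [DecidableEq ι] : Set (Matrix ι ι ℂ) :=
  {T | T.PosSemidef ∧ (1 - T).PosSemidef}

/-- The expected error probability `p tr((I - Π) σ₁) + (1 - p) tr(Π σ₂)` of the test `Π = T`. -/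
def simpleError {ι : Type*} [Fintype ι] [DecidableEq ι] (T : Matrix ι ι ℂ) (p : ℝ)
    (σ₁ σ₂ : Matrix ι ι ℂ) : ℝ :=
  p * ((1 - T) * σ₁).trace.re + (1 - p) * (T * σ₂).trace.re

/-- The worst-case expected error probability of the test `T` on `n` copies:
the supremum of the error probability over all pairs of states `ρ₁ ∈ D₁`, `ρ₂ ∈ D₂`. -/
def compositeError {d : ℕ} (n : ℕ) (T : Matrix (Fin n → Fin d) (Fin n → Fin d) ℂ) (p : ℝ)
    (D₁ D₂ : Set (DensityMatrix d)) : ℝ :=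
  sSup (Set.image2
    (fun ρ₁ ρ₂ : DensityMatrix d => simpleError T p (tensorPower n ρ₁.1) (tensorPower n ρ₂.1))
    D₁ D₂)

/-- The min-max expected error probability on `n` copies:
the infimum of the worst-case error probability over all two-outcome POVMs. -/
def minError {d : ℕ} (n : ℕ) (p : ℝ) (D₁ D₂ : Set (DensityMatrix d)) : ℝ :=
  sInf ((fun T => compositeError n T p D₁ D₂) '' tests (Fin n → Fin d))

/-- The `δ`-sample complexity `n*(δ)`: the least number `n ≥ 1` of copies for which the min-max
expected error probability is at most `δ`; it is `⊤` if there is no such `n`. -/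
def sampleComplexity {d : ℕ} (p : ℝ) (D₁ D₂ : Set (DensityMatrix d)) (δ : ℝ) : ℕ∞ :=
  ⨅ n ∈ {n : ℕ | 1 ≤ n ∧ minError n p D₁ D₂ ≤ δ}, (n : ℕ∞)

end QHT

end

/-! Both directions rest on the fidelity being multiplicative on tensor powers
(`traceNorm_tensorPower_fidelity`), so the error decays geometrically in `n` at a rate set by
`F_max`.

Upper bound: since the error is affine in the test and the tests form a convex set, minimax
(`exists_forall_lt_of_stdSimplex`) reduces the worst case over pairs to a fixed mixture of pairs. A
mixture is a binary problem between two weighted sums of states, where the Powers–Størmer test has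
error at most `tr √A √B`. Douglas factorization splits this trace into pairwise fidelities
(`trace_sqrt_sum_mul_sqrt_sum_le`), and Cauchy–Schwarz on the weights yields the factor `√(m₁ m₂)`.
The result is `minError_le`.

Lower bound: measuring cannot decrease fidelity, so for a pair attaining `F_max` any test with error
`e` satisfies `p (1 - p) F_max ^ (2n) ≤ e (1 - e)` (`sq_traceNorm_le_simpleError`). Taking
logarithms in `le_of_minError_le` bounds `n` from below. -/

namespace QHT

/-! ### Square roots, contractions and trace norm inequalities. -/

section MatrixInequalities

variable {ι : Type*} [Fintype ι]

theorem trace_re_nonneg {A : Matrix ι ι ℂ} (hA : A.PosSemidef) : 0 ≤ A.trace.re :=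
  (Complex.le_def.1 hA.trace_nonneg).1

/-- The Cauchy–Schwarz inequality for the Hilbert–Schmidt inner product. -/
theorem norm_trace_conjTranspose_mul_le (X Y : Matrix ι ι ℂ) :
    ‖(Xᴴ * Y).trace‖ ≤ √((Xᴴ * X).trace.re) * √((Yᴴ * Y).trace.re) := by
  have h : ∀ Z W : Matrix ι ι ℂ,
      (Zᴴ * W).trace = ∑ q : ι × ι, star (Z q.2 q.1) * W q.2 q.1 := fun Z W => by
    simp [Matrix.trace, Matrix.mul_apply, Fintype.sum_prod_type]
  have h2 : ∀ Z : Matrix ι ι ℂ, (Zᴴ * Z).trace.re = ∑ q : ι × ι, ‖Z q.2 q.1‖ ^ 2 := fun Z => by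
    rw [h, Complex.re_sum]
    refine Finset.sum_congr rfl fun q _ => ?_
    rw [Complex.star_def, ← Complex.normSq_eq_conj_mul_self, Complex.ofReal_re,
      Complex.normSq_eq_norm_sq]
  rw [h, h2, h2]
  refine (norm_sum_le _ _).trans ?_
  simp only [norm_mul, norm_star]
  exact Real.sum_mul_le_sqrt_mul_sqrt _ _ _

variable [DecidableEq ι]

theorem continuousOn_spectrum (f : ℝ → ℝ) (A : Matrix ι ι ℂ) :
    ContinuousOn f (spectrum ℝ A) :=
  A.finite_real_spectrum.continuousOn f

theorem sqrt_posSemidef (A : Matrix ι ι ℂ) : (CFC.sqrt A).PosSemidef :=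
  Matrix.nonneg_iff_posSemidef.1 (CFC.sqrt_nonneg A)

theorem sqrt_conjTranspose (A : Matrix ι ι ℂ) : (CFC.sqrt A)ᴴ = CFC.sqrt A :=
  (sqrt_posSemidef A).isHermitian

theorem sqrt_mul_sqrt {A : Matrix ι ι ℂ} (hA : A.PosSemidef) : CFC.sqrt A * CFC.sqrt A = A :=
  CFC.sqrt_mul_sqrt_self A hA.nonneg

theorem sqrt_eq_of_mul_self {A B : Matrix ι ι ℂ} (hB : B.PosSemidef) (h : B * B = A) :
    CFC.sqrt A = B :=
  CFC.sqrt_unique h hB.nonneg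

/-- A Hermitian pseudo-inverse of the square root of a positive semidefinite matrix. -/
theorem exists_pinv_sqrt {A : Matrix ι ι ℂ} (hA : A.PosSemidef) :
    ∃ G : Matrix ι ι ℂ, Gᴴ = G ∧ G * A = CFC.sqrt A ∧ A * G = CFC.sqrt A ∧
      (1 - G * A * G).PosSemidef := by
  have hs : IsSelfAdjoint A := hA.isHermitian
  have hc := fun f => continuousOn_spectrum f A
  have hsqrt : CFC.sqrt A = cfc Real.sqrt A := by
    rw [CFC.sqrt_eq_real_sqrt A hA.nonneg,
      cfcₙ_eq_cfc (hf := Real.continuous_sqrt.continuousOn) (hf0 := Real.sqrt_zero)]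
  have h0 : ∀ x ∈ spectrum ℝ A, 0 ≤ x := spectrum_nonneg_of_nonneg hA.nonneg
  have hid : cfc (fun x : ℝ => x) A = A := cfc_id' ℝ A hs
  -- The convention `0⁻¹ = 0` makes this hold at `x = 0`, so the inverse root acts as zero on the
  -- kernel.
  have key : ∀ x : ℝ, 0 ≤ x → (√x)⁻¹ * x = √x := fun x hx => by
    rcases hx.eq_or_lt with rfl | hx
    · simp
    · have := Real.sqrt_pos.2 hx
      field_simp
      rw [Real.sq_sqrt hx.le]
  have h1 : cfc (fun x : ℝ => (√x)⁻¹) A * A = CFC.sqrt A := by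
    have h := cfc_mul (fun x : ℝ => (√x)⁻¹) (fun x => x) A (hc _) (hc _)
    rw [hid] at h
    rw [hsqrt, ← h]
    exact cfc_congr fun x hx => key x (h0 x hx)
  have hG : (cfc (fun x : ℝ => (√x)⁻¹) A)ᴴ = cfc (fun x : ℝ => (√x)⁻¹) A :=
    (cfc_predicate (fun x : ℝ => (√x)⁻¹) A : IsSelfAdjoint _)
  have h2 : A * cfc (fun x : ℝ => (√x)⁻¹) A = CFC.sqrt A := by
    have := congrArg Matrix.conjTranspose h1
    rwa [Matrix.conjTranspose_mul, hG, sqrt_conjTranspose, hA.isHermitian.eq] at this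
  refine ⟨cfc (fun x : ℝ => (√x)⁻¹) A, hG, h1, h2, ?_⟩
  rw [h1, hsqrt, ← cfc_mul _ _ A (hc _) (hc _), ← cfc_one ℝ A hs, ← cfc_sub _ _ A (hc _) (hc _)]
  refine Matrix.nonneg_iff_posSemidef.1 (cfc_nonneg fun x hx => ?_)
  simp only [sub_nonneg, Pi.one_apply]
  exact mul_inv_le_one

theorem trace_mul_nonneg {A B : Matrix ι ι ℂ} (hA : A.PosSemidef) (hB : B.PosSemidef) :
    0 ≤ (A * B).trace.re := by
  have h : (A * B).trace = ((CFC.sqrt B)ᴴ * A * CFC.sqrt B).trace := by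
    rw [sqrt_conjTranspose, Matrix.trace_mul_comm _ (CFC.sqrt B), ← mul_assoc, sqrt_mul_sqrt hB,
      Matrix.trace_mul_comm]
  rw [h]
  exact (Complex.le_def.1 (hA.conjTranspose_mul_mul_same _).trace_nonneg).1

/-- The Powers–Størmer test. -/
theorem exists_test_le_trace_sqrt_mul_sqrt {A B : Matrix ι ι ℂ} (hA : A.PosSemidef)
    (hB : B.PosSemidef) : ∃ T ∈ tests ι,
      ((1 - T) * A).trace.re + (T * B).trace.re ≤ (CFC.sqrt A * CFC.sqrt B).trace.re := by
  have ha := sqrt_posSemidef A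
  have hb := sqrt_posSemidef B
  have hA2 := sqrt_mul_sqrt hA
  have hB2 := sqrt_mul_sqrt hB
  set a := CFC.sqrt A
  set b := CFC.sqrt B
  have hs : IsSelfAdjoint (a - b) := (ha.isHermitian.sub hb.isHermitian :)
  have hc := fun f => continuousOn_spectrum f (a - b)
  have hid : cfc (fun x : ℝ => x) (a - b) = a - b := cfc_id' ℝ (a - b) hs
  -- The test is the spectral projection of `√A - √B`, not of `A - B`, onto `[0, ∞)`.
  set T := cfc (fun x : ℝ => if 0 ≤ x then (1 : ℝ) else 0) (a - b) with hT
  have h1T : 1 - T = cfc (fun x : ℝ => if 0 ≤ x then (0 : ℝ) else 1) (a - b) := by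
    rw [hT, ← cfc_one ℝ (a - b) hs, ← cfc_sub _ _ _ (hc _) (hc _)]
    refine cfc_congr fun x _ => ?_
    by_cases h : 0 ≤ x <;> simp [h]
  have hp : (T * (a - b)).PosSemidef := by
    rw [hT]
    nth_rw 2 [← hid]
    rw [← cfc_mul _ _ _ (hc _) (hc _)]
    refine Matrix.nonneg_iff_posSemidef.1 (cfc_nonneg fun x hx => ?_)
    by_cases h : 0 ≤ x <;> simp [h]
  have hm : (-((a - b) * (1 - T))).PosSemidef := by
    rw [h1T]
    nth_rw 1 [← hid]
    rw [← cfc_mul _ _ _ (hc _) (hc _), ← cfc_neg]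
    refine Matrix.nonneg_iff_posSemidef.1 (cfc_nonneg fun x hx => ?_)
    by_cases h : 0 ≤ x
    · simp [h]
    · simpa [h] using (not_le.1 h).le
  refine ⟨T, ⟨?_, ?_⟩, ?_⟩
  · refine Matrix.nonneg_iff_posSemidef.1 (cfc_nonneg fun x hx => ?_)
    by_cases h : 0 ≤ x <;> simp [h]
  · rw [h1T]
    refine Matrix.nonneg_iff_posSemidef.1 (cfc_nonneg fun x hx => ?_)
    by_cases h : 0 ≤ x <;> simp [h]
  · have e1 := trace_mul_nonneg hp hb
    have e2 := trace_mul_nonneg hm ha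
    have e3 : (-((a - b) * (1 - T)) * a).trace = -((1 - T) * (a * (a - b))).trace := by
      rw [neg_mul, Matrix.trace_neg, mul_assoc, Matrix.trace_mul_comm, mul_assoc]
    have e4 : (a * b).trace = ((1 - T) * A).trace + (T * B).trace
        + ((T * (a - b) * b).trace + -((1 - T) * (a * (a - b))).trace) := by
      rw [← hA2, ← hB2, ← Matrix.trace_neg, ← Matrix.trace_add, ← Matrix.trace_add,
        ← Matrix.trace_add]
      congr 1
      noncomm_ring
    rw [e3] at e2
    rw [e4]
    simp only [Complex.add_re] at *
    linarith

theorem traceNorm_nonneg (X : Matrix ι ι ℂ) : 0 ≤ traceNorm X :=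
  trace_re_nonneg (sqrt_posSemidef _)

/-- A contraction, in terms of the positive semidefinite order. -/
def IsContraction (C : Matrix ι ι ℂ) : Prop := (1 - Cᴴ * C).PosSemidef

/-- `1 - CᴴC` and `1 - CCᴴ` are the two Schur complements of the block matrix with rows `(1, C)` and
`(Cᴴ, 1)`. -/
theorem IsContraction.conjTranspose {C : Matrix ι ι ℂ} (hC : IsContraction C) :
    IsContraction Cᴴ := by
  let _ : Invertible (1 : Matrix ι ι ℂ) := invertibleOne
  have h1 : (Matrix.fromBlocks 1 C Cᴴ 1).PosSemidef :=
    (Matrix.PosDef.fromBlocks₁₁ C 1 Matrix.PosDef.one).2 (by simpa [IsContraction] using hC)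
  have h2 := (Matrix.PosDef.fromBlocks₂₂ 1 C Matrix.PosDef.one).1 h1
  simpa [IsContraction] using h2

theorem IsContraction.mul {C E : Matrix ι ι ℂ} (hC : IsContraction C) (hE : IsContraction E) :
    IsContraction (C * E) := by
  have h := (hC.conjTranspose_mul_mul_same E).add hE
  have e : Eᴴ * (1 - Cᴴ * C) * E + (1 - Eᴴ * E) = 1 - (C * E)ᴴ * (C * E) := by
    rw [Matrix.conjTranspose_mul]; noncomm_ring
  rwa [e] at h

/-- A polar decomposition with a contraction in place of the partial isometry. -/
theorem exists_polar (X : Matrix ι ι ℂ) : ∃ W, IsContraction W ∧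
    W * X = CFC.sqrt (Xᴴ * X) ∧ X = Wᴴ * CFC.sqrt (Xᴴ * X) := by
  have hA := Matrix.posSemidef_conjTranspose_mul_self X
  obtain ⟨G, hG, h1, h2, h3⟩ := exists_pinv_sqrt hA
  have hs := sqrt_mul_sqrt hA
  refine ⟨G * Xᴴ, ?_, by rw [mul_assoc, h1], ?_⟩
  · have : IsContraction (G * Xᴴ)ᴴ := by
      rw [IsContraction]
      simpa [hG, mul_assoc] using h3
    simpa using this.conjTranspose
  -- `G * √(XᴴX)` is the support projection of `XᴴX`; it fixes `X` on the right because the Gram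
  -- matrix of the difference vanishes.
  · have h4 : Xᴴ * X * (G * CFC.sqrt (Xᴴ * X)) = Xᴴ * X := by rw [← mul_assoc, h2, hs]
    have h5 : (X - X * (G * CFC.sqrt (Xᴴ * X)))ᴴ * (X - X * (G * CFC.sqrt (Xᴴ * X))) = 0 := by
      set P := G * CFC.sqrt (Xᴴ * X)
      have : (X - X * P)ᴴ * (X - X * P) =
          Xᴴ * X - Xᴴ * X * P - Pᴴ * (Xᴴ * X - Xᴴ * X * P) := by
        rw [Matrix.conjTranspose_sub, Matrix.conjTranspose_mul]; noncomm_ring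
      rw [this, h4]; simp
    have h6 := sub_eq_zero.1 (Matrix.conjTranspose_mul_self_eq_zero.1 h5)
    simpa [hG, mul_assoc] using h6

/-- Polar decomposition absorbs the unitary part of `X` into the contraction; splitting `√(XᴴX) = R
* R` then allows Cauchy–Schwarz. -/
theorem norm_trace_mul_le_traceNorm {C : Matrix ι ι ℂ} (hC : IsContraction C)
    (X : Matrix ι ι ℂ) : ‖(C * X).trace‖ ≤ traceNorm X := by
  obtain ⟨W, hW, -, h2⟩ := exists_polar X
  have hM := sqrt_posSemidef (Xᴴ * X)
  have hn := traceNorm_nonneg X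
  rw [traceNorm] at *
  set M := CFC.sqrt (Xᴴ * X)
  have hs := sqrt_mul_sqrt hM
  have hst := sqrt_conjTranspose M
  set R := CFC.sqrt M
  have hD := (hC.mul hW.conjTranspose).conjTranspose
  set D := C * Wᴴ
  have e : (C * X).trace = ((Dᴴ * R)ᴴ * R).trace := by
    rw [h2, ← mul_assoc, ← hs, Matrix.conjTranspose_mul, hst, Matrix.conjTranspose_conjTranspose,
      mul_assoc R, Matrix.trace_mul_comm R, ← mul_assoc]
  rw [e]
  refine (norm_trace_conjTranspose_mul_le _ _).trans ?_
  have h3 : ((Dᴴ * R)ᴴ * (Dᴴ * R)).trace.re ≤ M.trace.re := by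
    have := trace_re_nonneg (hD.conjTranspose_mul_mul_same R)
    clear_value D
    have e2 : Rᴴ * (1 - Dᴴᴴ * Dᴴ) * R = M - (Dᴴ * R)ᴴ * (Dᴴ * R) := by
      rw [Matrix.conjTranspose_mul, ← hs, hst]; noncomm_ring
    rw [e2, Matrix.trace_sub, Complex.sub_re] at this
    linarith
  rw [hst, hs]
  calc _ ≤ √(M.trace.re) * √(M.trace.re) := by gcongr
    _ = M.trace.re := Real.mul_self_sqrt hn

/-- Douglas factorization of the square root of a sum. -/
theorem exists_sqrt_sum_factor {κ : Type*} [Fintype κ] {A : κ → Matrix ι ι ℂ}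
    (hA : ∀ k, (A k).PosSemidef) : ∃ V : κ → Matrix ι ι ℂ, (∀ k, IsContraction (V k)) ∧
      CFC.sqrt (∑ k, A k) = ∑ k, CFC.sqrt (A k) * V k := by
  have hS : (∑ k, A k).PosSemidef := Matrix.posSemidef_sum _ fun k _ => hA k
  obtain ⟨G, hG, h1, h2, h3⟩ := exists_pinv_sqrt hS
  refine ⟨fun k => CFC.sqrt (A k) * G, fun k => ?_, ?_⟩
  · classical
    -- `G A_k G ≤ G (∑ A_j) G ≤ 1`, the omitted terms being positive.
    have h4 : (G * (∑ j ∈ Finset.univ.erase k, A j) * G).PosSemidef := by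
      have := (Matrix.posSemidef_sum (Finset.univ.erase k)
        fun j _ => hA j).conjTranspose_mul_mul_same G
      rwa [hG] at this
    have := h3.add h4
    rw [← Finset.add_sum_erase _ _ (Finset.mem_univ k)] at this
    rw [IsContraction, Matrix.conjTranspose_mul, hG, sqrt_conjTranspose]
    convert this using 1
    conv_rhs => rw [← sqrt_mul_sqrt (hA k)]
    noncomm_ring
  · rw [← h2, Finset.sum_mul]
    exact Finset.sum_congr rfl fun k _ => by rw [← mul_assoc, sqrt_mul_sqrt (hA k)]

/-- After factoring both roots, each cross term is the trace of a contraction times `√A_k √B_l`.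
This reduces mixtures to pairs of states. -/
theorem trace_sqrt_sum_mul_sqrt_sum_le {κ κ' : Type*} [Fintype κ] [Fintype κ']
    {A : κ → Matrix ι ι ℂ} {B : κ' → Matrix ι ι ℂ} (hA : ∀ k, (A k).PosSemidef)
    (hB : ∀ k, (B k).PosSemidef) :
    (CFC.sqrt (∑ k, A k) * CFC.sqrt (∑ k, B k)).trace.re ≤
      ∑ k, ∑ l, traceNorm (CFC.sqrt (A k) * CFC.sqrt (B l)) := by
  obtain ⟨V, hV, hVA⟩ := exists_sqrt_sum_factor hA
  obtain ⟨U, hU, hUB⟩ := exists_sqrt_sum_factor hB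
  have hVA' : CFC.sqrt (∑ k, A k) = ∑ k, (V k)ᴴ * CFC.sqrt (A k) := by
    rw [← sqrt_conjTranspose, hVA, Matrix.conjTranspose_sum]
    simp [sqrt_conjTranspose]
  rw [hVA', hUB, Finset.sum_mul_sum, Matrix.trace_sum, Complex.re_sum]
  refine Finset.sum_le_sum fun k _ => ?_
  rw [Matrix.trace_sum, Complex.re_sum]
  refine Finset.sum_le_sum fun l _ => ?_
  have e : ((V k)ᴴ * CFC.sqrt (A k) * (CFC.sqrt (B l) * U l)).trace =
      ((U l * (V k)ᴴ) * (CFC.sqrt (A k) * CFC.sqrt (B l))).trace := by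
    rw [← mul_assoc, Matrix.trace_mul_comm]; simp only [mul_assoc]
  rw [e]
  exact (Complex.re_le_norm _).trans
    (norm_trace_mul_le_traceNorm ((hU l).mul (hV k).conjTranspose) _)

theorem traceNorm_smul {c : ℝ} (hc : 0 ≤ c) (X : Matrix ι ι ℂ) :
    traceNorm (c • X) = c * traceNorm X := by
  have hX := Matrix.posSemidef_conjTranspose_mul_self X
  have : CFC.sqrt ((c • X)ᴴ * (c • X)) = c • CFC.sqrt (Xᴴ * X) := by
    refine sqrt_eq_of_mul_self ((sqrt_posSemidef _).smul hc) ?_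
    simp only [smul_mul_assoc, mul_smul_comm, sqrt_mul_sqrt hX, Matrix.conjTranspose_smul,
      star_trivial]
  rw [traceNorm, this, Matrix.trace_smul, Complex.real_smul, Complex.re_ofReal_mul, traceNorm]

theorem sqrt_smul {c : ℝ} (hc : 0 ≤ c) {A : Matrix ι ι ℂ} (hA : A.PosSemidef) :
    CFC.sqrt (c • A) = √c • CFC.sqrt A := by
  refine sqrt_eq_of_mul_self ((sqrt_posSemidef _).smul (Real.sqrt_nonneg c)) ?_
  rw [smul_mul_smul_comm, sqrt_mul_sqrt hA, Real.mul_self_sqrt hc]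

end MatrixInequalities

/-! ### Multiplicativity under tensor powers. -/

section TensorPower

variable {d : ℕ} (n : ℕ)

theorem tensorPower_mul (A B : Matrix (Fin d) (Fin d) ℂ) :
    tensorPower n (A * B) = tensorPower n A * tensorPower n B := by
  ext i j
  simp only [tensorPower, Matrix.of_apply, Matrix.mul_apply, Finset.prod_univ_sum,
    Fintype.piFinset_univ, Finset.prod_mul_distrib]

theorem tensorPower_conjTranspose (A : Matrix (Fin d) (Fin d) ℂ) :
    tensorPower n Aᴴ = (tensorPower n A)ᴴ := by
  ext i j
  simp [tensorPower]

theorem trace_tensorPower (A : Matrix (Fin d) (Fin d) ℂ) :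
    (tensorPower n A).trace = A.trace ^ n := by
  simp only [tensorPower, Matrix.trace, Matrix.diag_apply, Matrix.of_apply]
  rw [← Fin.prod_const n, Finset.prod_univ_sum, Fintype.piFinset_univ]

theorem tensorPower_posSemidef {A : Matrix (Fin d) (Fin d) ℂ} (hA : A.PosSemidef) :
    (tensorPower n A).PosSemidef := by
  rw [← sqrt_mul_sqrt hA, tensorPower_mul]
  nth_rw 1 [← sqrt_conjTranspose]
  rw [tensorPower_conjTranspose]
  exact Matrix.posSemidef_conjTranspose_mul_self _

theorem sqrt_tensorPower {A : Matrix (Fin d) (Fin d) ℂ} (hA : A.PosSemidef) :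
    CFC.sqrt (tensorPower n A) = tensorPower n (CFC.sqrt A) :=
  sqrt_eq_of_mul_self (tensorPower_posSemidef n (sqrt_posSemidef A))
    (by rw [← tensorPower_mul, sqrt_mul_sqrt hA])

theorem traceNorm_tensorPower (X : Matrix (Fin d) (Fin d) ℂ) :
    traceNorm (tensorPower n X) = traceNorm X ^ n := by
  have h0 : ((CFC.sqrt (Xᴴ * X)).trace.re : ℂ) = (CFC.sqrt (Xᴴ * X)).trace :=
    Complex.ext rfl (Complex.le_def.1 (sqrt_posSemidef (Xᴴ * X)).trace_nonneg).2
  rw [traceNorm, traceNorm, ← tensorPower_conjTranspose, ← tensorPower_mul,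
    sqrt_tensorPower n (Matrix.posSemidef_conjTranspose_mul_self X), trace_tensorPower, ← h0,
    ← Complex.ofReal_pow, Complex.ofReal_re, Complex.ofReal_re]

end TensorPower

/-! ### Fidelity: behaviour under tests, and strict bounds. -/

section Fidelity

variable {ι : Type*} [Fintype ι] [DecidableEq ι]

/-- The fidelity is dominated by the classical fidelity of the outcomes of any test. -/
theorem traceNorm_sqrt_mul_sqrt_le {A B T : Matrix ι ι ℂ} (hA : A.PosSemidef)
    (hB : B.PosSemidef) (hT : T ∈ tests ι) :
    traceNorm (CFC.sqrt A * CFC.sqrt B) ≤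
      √((T * A).trace.re) * √((T * B).trace.re) +
        √(((1 - T) * A).trace.re) * √(((1 - T) * B).trace.re) := by
  obtain ⟨W, hW, h1, -⟩ := exists_polar (CFC.sqrt A * CFC.sqrt B)
  have ha := sqrt_conjTranspose A
  have hb := sqrt_conjTranspose B
  have hA2 := sqrt_mul_sqrt hA
  have hB2 := sqrt_mul_sqrt hB
  -- Cauchy–Schwarz for `√S √A Wᴴ` and `√S √B`; it is used for `S = T` and `S = 1 - T`, which sum to
  -- the identity.
  have key : ∀ S : Matrix ι ι ℂ, S.PosSemidef →
      (W * CFC.sqrt A * S * CFC.sqrt B).trace.re ≤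
        √((S * A).trace.re) * √((S * B).trace.re) := fun S hS => by
    have hs := sqrt_conjTranspose S
    have hS2 := sqrt_mul_sqrt hS
    set a := CFC.sqrt A
    set b := CFC.sqrt B
    set s := CFC.sqrt S
    have e : W * a * S * b = (s * a * Wᴴ)ᴴ * (s * b) := by
      simp only [Matrix.conjTranspose_mul, Matrix.conjTranspose_conjTranspose, ha, hs, ← hS2,
        mul_assoc]
    rw [e]
    refine ((Complex.re_le_norm _).trans (norm_trace_conjTranspose_mul_le _ _)).trans ?_
    have e2 : ((s * b)ᴴ * (s * b)).trace = (S * B).trace := by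
      rw [Matrix.conjTranspose_mul, hb, hs, mul_assoc, Matrix.trace_mul_comm, ← hB2, ← hS2]
      simp only [mul_assoc]
    have e3 : ((s * a * Wᴴ)ᴴ * (s * a * Wᴴ)).trace.re ≤ (S * A).trace.re := by
      have h := trace_mul_nonneg hW ((hS.conjTranspose_mul_mul_same a))
      have e4 : (S * A).trace = (aᴴ * S * a).trace := by
        rw [Matrix.trace_mul_comm, ← hA2, ha, mul_assoc, mul_assoc, Matrix.trace_mul_comm]
        simp only [mul_assoc]
      have e5 : ((s * a * Wᴴ)ᴴ * (s * a * Wᴴ)).trace = (Wᴴ * W * (aᴴ * S * a)).trace := by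
        have : (s * a * Wᴴ)ᴴ * (s * a * Wᴴ) = W * (aᴴ * S * a * Wᴴ) := by
          simp only [Matrix.conjTranspose_mul, Matrix.conjTranspose_conjTranspose, hs, ← hS2,
            mul_assoc]
        rw [this, Matrix.trace_mul_comm, mul_assoc, Matrix.trace_mul_comm]
      rw [sub_mul, one_mul, Matrix.trace_sub, Complex.sub_re] at h
      rw [e4, e5]
      linarith
    rw [e2]
    gcongr
  have e : traceNorm (CFC.sqrt A * CFC.sqrt B) =
      (W * CFC.sqrt A * T * CFC.sqrt B).trace.re +
        (W * CFC.sqrt A * (1 - T) * CFC.sqrt B).trace.re := by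
    rw [traceNorm, ← h1, ← Complex.add_re, ← Matrix.trace_add]
    congr 2
    noncomm_ring
  rw [e]
  exact add_le_add (key T hT.1) (key (1 - T) hT.2)

variable {d : ℕ} (ρ σ : DensityMatrix d)

theorem fidelity_nonneg : 0 ≤ fidelity ρ σ := traceNorm_nonneg _

/-- With `a = √ρ`, `b = √σ` and `W` the polar contraction, `‖W a - b‖₂² + tr (a (1 - WᴴW) a) = 2 -
2F`. If `F ≥ 1`, both nonnegative terms vanish, so `σ = (W a)ᴴ (W a) = ρ`. -/
theorem fidelity_lt_one (h : ρ ≠ σ) : fidelity ρ σ < 1 := by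
  obtain ⟨W, hW, h1, -⟩ := exists_polar (CFC.sqrt ρ.1 * CFC.sqrt σ.1)
  have ha := sqrt_conjTranspose ρ.1
  have hb := sqrt_conjTranspose σ.1
  have hA2 := sqrt_mul_sqrt ρ.2.1
  have hB2 := sqrt_mul_sqrt σ.2.1
  by_contra hF
  rw [not_lt, fidelity, traceNorm, ← h1] at hF
  set a := CFC.sqrt ρ.1
  set b := CFC.sqrt σ.1
  have hF' : (b * (a * Wᴴ)).trace.re = (W * (a * b)).trace.re := by
    have : b * (a * Wᴴ) = (W * (a * b))ᴴ := by
      simp only [Matrix.conjTranspose_mul, ha, hb, mul_assoc]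
    rw [this, Matrix.trace_conjTranspose, Complex.star_def, Complex.conj_re]
  have hK : (aᴴ * (1 - Wᴴ * W) * a).PosSemidef := hW.conjTranspose_mul_mul_same a
  have hKtr : (aᴴ * (1 - Wᴴ * W) * a).trace.re = 1 - (W * (a * a) * Wᴴ).trace.re := by
    have e : aᴴ * (1 - Wᴴ * W) * a = ρ.1 - a * Wᴴ * (W * a) := by
      rw [ha, ← hA2]; noncomm_ring
    rw [e, Matrix.trace_sub, ρ.2.2, Matrix.trace_mul_comm (a * Wᴴ)]
    simp [mul_assoc]
  set Y := W * a - b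
  have hY : (Y * Yᴴ).trace.re = (W * (a * a) * Wᴴ).trace.re + 1 - 2 * (W * (a * b)).trace.re := by
    have e : Y * Yᴴ = W * (a * a) * Wᴴ + σ.1 - W * (a * b) - b * (a * Wᴴ) := by
      simp only [Y, Matrix.conjTranspose_sub, Matrix.conjTranspose_mul, ha, hb, ← hB2]
      noncomm_ring
    rw [e]
    simp only [Matrix.trace_sub, Matrix.trace_add, Complex.sub_re, Complex.add_re, σ.2.2, hF',
      Complex.one_re]
    ring
  have hY0 := Matrix.posSemidef_self_mul_conjTranspose Y
  have hY1 := trace_re_nonneg hY0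
  have hK1 := trace_re_nonneg hK
  have eq_zero : ∀ P : Matrix (Fin d) (Fin d) ℂ, P.PosSemidef → P.trace.re = 0 → P = 0 :=
    fun P hP h => hP.trace_eq_zero_iff.1
      (Complex.ext h (Complex.le_def.1 hP.trace_nonneg).2.symm)
  have hY2 : Y = 0 := Matrix.self_mul_conjTranspose_eq_zero.1 (eq_zero _ hY0 (by linarith))
  have hK2 := eq_zero _ hK (by linarith)
  have hWa : W * a = b := sub_eq_zero.1 hY2
  apply h
  apply Subtype.ext
  have e : aᴴ * (1 - Wᴴ * W) * a = ρ.1 - (W * a)ᴴ * (W * a) := by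
    rw [Matrix.conjTranspose_mul, ha, ← hA2]; noncomm_ring
  rw [e, hWa, hb, hB2] at hK2
  exact sub_eq_zero.1 hK2

theorem fidelity_pos (h : ρ.1 * σ.1 ≠ 0) : 0 < fidelity ρ σ := by
  refine lt_of_le_of_ne (fidelity_nonneg ρ σ) fun h0 => h ?_
  have hA2 := sqrt_mul_sqrt ρ.2.1
  have hB2 := sqrt_mul_sqrt σ.2.1
  set X := CFC.sqrt ρ.1 * CFC.sqrt σ.1 with hX
  have hM := sqrt_posSemidef (Xᴴ * X)
  have h1 : CFC.sqrt (Xᴴ * X) = 0 := hM.trace_eq_zero_iff.1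
    (Complex.ext h0.symm (Complex.le_def.1 hM.trace_nonneg).2.symm)
  obtain ⟨W, -, -, h2⟩ := exists_polar X
  rw [h1, mul_zero] at h2
  calc ρ.1 * σ.1 = CFC.sqrt ρ.1 * X * CFC.sqrt σ.1 := by
        nth_rw 1 [← hA2, ← hB2]; simp only [hX, mul_assoc]
    _ = 0 := by rw [h2]; simp

theorem traceNorm_tensorPower_fidelity (n : ℕ) :
    traceNorm (CFC.sqrt (tensorPower n ρ.1) * CFC.sqrt (tensorPower n σ.1)) =
      fidelity ρ σ ^ n := by
  rw [sqrt_tensorPower n ρ.2.1, sqrt_tensorPower n σ.2.1, ← tensorPower_mul,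
    traceNorm_tensorPower, fidelity]

end Fidelity

/-! ### Minimax by separation of convex sets. -/

section Minimax

/-- A finite minimax theorem: finitely many convex payoffs can be made small simultaneously when
all their mixtures can be made small. -/
theorem exists_forall_lt_of_stdSimplex {E κ : Type*} [AddCommGroup E] [Module ℝ E] [Fintype κ]
    {S : Set E} {g : κ → E → ℝ} (hg : ∀ k, ConvexOn ℝ S (g k)) (hS : Convex ℝ S)
    (hne : S.Nonempty) {c : ℝ}
    (h : ∀ w ∈ stdSimplex ℝ κ, ∃ T ∈ S, ∑ k, w k * g k T < c) :
    ∃ T ∈ S, ∀ k, g k T < c := by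
  classical
  by_contra! hcon
  let U : Set (κ → ℝ) := {v | ∀ k, v k < c}
  -- The upward closure of the payoff vectors: convexity of the `g k` makes it convex, and being
  -- upward closed forces the separating functional to have nonnegative weights.
  let K : Set (κ → ℝ) := {v | ∃ T ∈ S, ∀ k, g k T ≤ v k}
  have hU : U = Set.univ.pi fun _ => Set.Iio c := by ext; simp [U]
  have hUc : Convex ℝ U := hU ▸ convex_pi fun _ _ => convex_Iio c
  have hUo : IsOpen U := hU ▸ isOpen_set_pi Set.finite_univ fun _ _ => isOpen_Iio
  have hK : Convex ℝ K := by
    rintro v ⟨T, hT, hv⟩ v' ⟨T', hT', hv'⟩ a b ha hb hab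
    refine ⟨a • T + b • T', hS hT hT' ha hb hab, fun k => ((hg k).2 hT hT' ha hb hab).trans ?_⟩
    simp only [Pi.add_apply, Pi.smul_apply, smul_eq_mul]
    have := hv k
    have := hv' k
    gcongr
  have hd : Disjoint U K := Set.disjoint_left.2 fun v hv ⟨T, hT, hTv⟩ => by
    obtain ⟨k, hk⟩ := hcon T hT
    exact absurd (hv k) (not_lt.2 (hk.trans (hTv k)))
  obtain ⟨f, u, hf1, hf2⟩ := geometric_hahn_banach_open hUc hUo hK hd
  set w : κ → ℝ := fun k => f (Pi.single k 1)
  have hf : ∀ v, f v = ∑ k, v k * w k := fun v => by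
    conv_lhs => rw [pi_eq_sum_univ' v]
    simp [w]
  obtain ⟨T₀, hT₀⟩ := hne
  have hw : ∀ k, 0 ≤ w k := fun k => by
    by_contra! hk
    have key : ∀ t : ℝ, 0 ≤ t → u ≤ f (fun j => g j T₀) + t * w k := fun t ht => by
      have := hf2 ((fun j => g j T₀) + t • Pi.single k 1) ⟨T₀, hT₀, fun j => by
        by_cases hj : j = k
        · subst hj; simpa using ht
        · simp [hj]⟩
      simpa [w] using this
    have h0 := key 0 le_rfl
    -- This `t` makes the right side of `key` equal to `u - 1`.
    have := key ((f (fun j => g j T₀) - u + 1) / -w k) (div_nonneg (by linarith) (by linarith))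
    rw [div_mul_eq_mul_div, div_neg, mul_div_cancel_right₀ _ hk.ne] at this
    linarith
  have hb : ∀ b, b < c → b * ∑ k, w k < u := fun b hb => by
    have := hf1 (fun _ => b) fun _ => hb
    rwa [hf, ← Finset.mul_sum] at this
  have hK' : ∀ T ∈ S, u ≤ ∑ k, g k T * w k := fun T hT => by
    have := hf2 (fun k => g k T) ⟨T, hT, fun _ => le_rfl⟩
    rwa [hf] at this
  have hW : 0 < ∑ k, w k := by
    refine lt_of_le_of_ne (Finset.sum_nonneg fun k _ => hw k) fun h0 => ?_
    have h1 := (Finset.sum_eq_zero_iff_of_nonneg fun k _ => hw k).1 h0.symm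
    have h2 := hb (c - 1) (by linarith)
    have h3 := hK' T₀ hT₀
    rw [← h0, mul_zero] at h2
    rw [Finset.sum_eq_zero fun k hk => by rw [h1 k hk, mul_zero]] at h3
    linarith
  obtain ⟨T, hT, hlt⟩ := h (fun k => w k / ∑ j, w j)
    ⟨fun k => div_nonneg (hw k) hW.le, by rw [← Finset.sum_div, div_self hW.ne']⟩
  have h1 := hb _ hlt
  have h2 : (∑ k, w k / (∑ j, w j) * g k T) * ∑ k, w k = ∑ k, g k T * w k := by
    rw [Finset.sum_mul]
    refine Finset.sum_congr rfl fun k _ => ?_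
    field_simp
  rw [h2] at h1
  exact absurd (hK' T hT) (not_le.2 h1)

end Minimax

/-! ### The set of tests and the error of a simple pair. -/

section Tests

variable {ι : Type*} [Fintype ι] [DecidableEq ι]

theorem convex_tests : Convex ℝ (tests ι) := by
  rintro X ⟨hX, hX'⟩ Y ⟨hY, hY'⟩ a b ha hb hab
  refine ⟨(hX.smul ha).add (hY.smul hb), ?_⟩
  have e : 1 - (a • X + b • Y) = a • (1 - X) + b • (1 - Y) := by
    have : (1 : Matrix ι ι ℂ) = a • 1 + b • 1 := by rw [← add_smul, hab, one_smul]
    nth_rw 1 [this]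
    module
  rw [e]
  exact (hX'.smul ha).add (hY'.smul hb)

theorem zero_mem_tests : (0 : Matrix ι ι ℂ) ∈ tests ι :=
  ⟨Matrix.PosSemidef.zero, by simpa using Matrix.PosSemidef.one⟩

theorem convexOn_simpleError (p : ℝ) (A B : Matrix ι ι ℂ) :
    ConvexOn ℝ (tests ι) fun T => simpleError T p A B := by
  refine ⟨convex_tests, fun X _ Y _ a b _ _ hab => le_of_eq ?_⟩
  have e : 1 - (a • X + b • Y) = a • (1 - X) + b • (1 - Y) := by
    have : (1 : Matrix ι ι ℂ) = a • 1 + b • 1 := by rw [← add_smul, hab, one_smul]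
    nth_rw 1 [this]
    module
  simp only [simpleError, e]
  simp only [add_mul, smul_mul_assoc, Matrix.trace_add, Matrix.trace_smul, Complex.add_re,
    Complex.smul_re, smul_eq_mul]
  ring

theorem simpleError_nonneg {p : ℝ} (hp : p ∈ Set.Ioo (0 : ℝ) 1) {T A B : Matrix ι ι ℂ}
    (hT : T ∈ tests ι) (hA : A.PosSemidef) (hB : B.PosSemidef) : 0 ≤ simpleError T p A B :=
  add_nonneg (mul_nonneg hp.1.le (trace_mul_nonneg hT.2 hA))
    (mul_nonneg (sub_nonneg.2 hp.2.le) (trace_mul_nonneg hT.1 hB))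

theorem sq_traceNorm_le_simpleError {p : ℝ} (hp : p ∈ Set.Ioo (0 : ℝ) 1) {T A B : Matrix ι ι ℂ}
    (hT : T ∈ tests ι) (hA : A.PosSemidef) (hB : B.PosSemidef) (hA1 : A.trace = 1)
    (hB1 : B.trace = 1) :
    p * (1 - p) * traceNorm (CFC.sqrt A * CFC.sqrt B) ^ 2 ≤
      simpleError T p A B * (1 - simpleError T p A B) := by
  have h := traceNorm_sqrt_mul_sqrt_le hA hB hT
  have h0 := traceNorm_nonneg (CFC.sqrt A * CFC.sqrt B)
  have hx := trace_mul_nonneg hT.1 hA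
  have hy := trace_mul_nonneg hT.1 hB
  have hx' := trace_mul_nonneg hT.2 hA
  have hy' := trace_mul_nonneg hT.2 hB
  have e1 : (T * A).trace.re = 1 - ((1 - T) * A).trace.re := by
    rw [sub_mul, one_mul, Matrix.trace_sub, hA1, Complex.sub_re, Complex.one_re]; ring
  have e2 : ((1 - T) * B).trace.re = 1 - (T * B).trace.re := by
    rw [sub_mul, one_mul, Matrix.trace_sub, hB1, Complex.sub_re, Complex.one_re]
  rw [simpleError]
  set F := traceNorm (CFC.sqrt A * CFC.sqrt B)
  have hxs := Real.sq_sqrt hx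
  have hys := Real.sq_sqrt hy
  have hxs' := Real.sq_sqrt hx'
  have hys' := Real.sq_sqrt hy'
  set a := √((T * A).trace.re)
  set b := √((T * B).trace.re)
  set a' := √(((1 - T) * A).trace.re)
  set b' := √(((1 - T) * B).trace.re)
  have e3 : 1 - (p * ((1 - T) * A).trace.re + (1 - p) * (T * B).trace.re) =
      p * a ^ 2 + (1 - p) * b' ^ 2 := by rw [hxs, hys', e1, e2]; ring
  rw [e3, ← hxs', ← hys]
  have hpp : 0 ≤ p * (1 - p) := mul_nonneg hp.1.le (sub_nonneg.2 hp.2.le)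
  calc p * (1 - p) * F ^ 2 ≤ p * (1 - p) * (a * b + a' * b') ^ 2 := by gcongr
    -- With `e = p a'² + (1 - p) b²`, the gap is exactly the square of `(1 - p) b b' - p a a'`.
    _ ≤ _ := by nlinarith [sq_nonneg ((1 - p) * b * b' - p * a * a')]

end Tests

/-! ### Bounds on the min-max error and the sample complexity. -/

variable {d : ℕ} {D₁ D₂ : Set (DensityMatrix d)}

theorem tensorPower_trace_eq_one (n : ℕ) (ρ : DensityMatrix d) :
    (tensorPower n ρ.1).trace = 1 := by
  rw [trace_tensorPower, ρ.2.2, one_pow]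

theorem exists_fidelity_eq_maxFidelity (h₁ : D₁.Finite) (h₂ : D₂.Finite) (hn₁ : D₁.Nonempty)
    (hn₂ : D₂.Nonempty) : ∃ ρ ∈ D₁, ∃ σ ∈ D₂, fidelity ρ σ = maxFidelity D₁ D₂ :=
  (hn₁.image2 hn₂).csSup_mem (h₁.image2 _ h₂)

theorem fidelity_le_maxFidelity (h₁ : D₁.Finite) (h₂ : D₂.Finite) {ρ σ : DensityMatrix d}
    (hρ : ρ ∈ D₁) (hσ : σ ∈ D₂) : fidelity ρ σ ≤ maxFidelity D₁ D₂ :=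
  le_csSup (h₁.image2 _ h₂).bddAbove (Set.mem_image2_of_mem hρ hσ)

theorem simpleError_le_compositeError (h₁ : D₁.Finite) (h₂ : D₂.Finite) {n : ℕ} {p : ℝ}
    {T : Matrix (Fin n → Fin d) (Fin n → Fin d) ℂ} {ρ σ : DensityMatrix d}
    (hρ : ρ ∈ D₁) (hσ : σ ∈ D₂) :
    simpleError T p (tensorPower n ρ.1) (tensorPower n σ.1) ≤ compositeError n T p D₁ D₂ :=
  le_csSup (h₁.image2 _ h₂).bddAbove (Set.mem_image2_of_mem
    (f := fun ρ₁ ρ₂ : DensityMatrix d =>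
      simpleError T p (tensorPower n ρ₁.1) (tensorPower n ρ₂.1)) hρ hσ)

/-- The mixtures of the `n`-copy error probabilities are controlled by the maximal fidelity. -/
theorem exists_test_sum_simpleError_le [Fintype D₁] [Fintype D₂] {p F : ℝ}
    (hp : p ∈ Set.Ioo (0 : ℝ) 1) (hF : ∀ ρ ∈ D₁, ∀ σ ∈ D₂, fidelity ρ σ ≤ F) (hF0 : 0 ≤ F)
    (n : ℕ) {w : D₁ × D₂ → ℝ} (hw : w ∈ stdSimplex ℝ (D₁ × D₂)) :
    ∃ T ∈ tests (Fin n → Fin d),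
      ∑ k, w k * simpleError T p (tensorPower n k.1.1.1) (tensorPower n k.2.1.1) ≤
        √(Fintype.card D₁ * Fintype.card D₂ * p * (1 - p)) * F ^ n := by
  -- Each error term involves only one of the two states, so the mixture depends on `w` only through
  -- its marginals.
  set q : D₁ → ℝ := fun i => ∑ j, w (i, j)
  set r : D₂ → ℝ := fun j => ∑ i, w (i, j)
  have hp' : 0 ≤ 1 - p := sub_nonneg.2 hp.2.le
  have hq : ∀ i, 0 ≤ q i := fun i => Finset.sum_nonneg fun j _ => hw.1 _
  have hr : ∀ j, 0 ≤ r j := fun j => Finset.sum_nonneg fun i _ => hw.1 _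
  have hq1 : ∑ i, q i = 1 := by rw [← hw.2, Fintype.sum_prod_type]
  have hr1 : ∑ j, r j = 1 := by rw [← hw.2, Fintype.sum_prod_type_right]
  have ht : ∀ ρ : DensityMatrix d, (tensorPower n ρ.1).PosSemidef := fun ρ =>
    tensorPower_posSemidef n ρ.2.1
  have hA : ∀ i : D₁, ((p * q i) • tensorPower n i.1.1).PosSemidef := fun i =>
    (ht i).smul (mul_nonneg hp.1.le (hq i))
  have hB : ∀ j : D₂, (((1 - p) * r j) • tensorPower n j.1.1).PosSemidef := fun j =>
    (ht j).smul (mul_nonneg hp' (hr j))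
  obtain ⟨T, hT, hle⟩ := exists_test_le_trace_sqrt_mul_sqrt
    (Matrix.posSemidef_sum Finset.univ fun i _ => hA i)
    (Matrix.posSemidef_sum Finset.univ fun j _ => hB j)
  refine ⟨T, hT, ?_⟩
  have e : ∑ k, w k * simpleError T p (tensorPower n k.1.1.1) (tensorPower n k.2.1.1) =
      ((1 - T) * ∑ i : D₁, (p * q i) • tensorPower n i.1.1).trace.re +
        (T * ∑ j : D₂, ((1 - p) * r j) • tensorPower n j.1.1).trace.re := by
    simp only [Finset.mul_sum, Matrix.trace_sum, Complex.re_sum, mul_smul_comm,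
      Matrix.trace_smul, Complex.smul_re, smul_eq_mul, simpleError, mul_add,
      Finset.sum_add_distrib]
    congr 1
    · rw [Fintype.sum_prod_type]
      refine Finset.sum_congr rfl fun i _ => ?_
      simp only [q, Finset.mul_sum, Finset.sum_mul]
      exact Finset.sum_congr rfl fun j _ => by ring
    · rw [Fintype.sum_prod_type_right]
      refine Finset.sum_congr rfl fun j _ => ?_
      simp only [r, Finset.mul_sum, Finset.sum_mul]
      exact Finset.sum_congr rfl fun i _ => by ring
  rw [e]
  refine (hle.trans (trace_sqrt_sum_mul_sqrt_sum_le hA hB)).trans ?_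
  have hterm : ∀ (i : D₁) (j : D₂), traceNorm
      (CFC.sqrt ((p * q i) • tensorPower n i.1.1) *
        CFC.sqrt (((1 - p) * r j) • tensorPower n j.1.1)) ≤
      √(q i) * (√(r j) * (√p * √(1 - p) * F ^ n)) := fun i j => by
    rw [sqrt_smul (mul_nonneg hp.1.le (hq i)) (ht i), sqrt_smul (mul_nonneg hp' (hr j)) (ht j),
      smul_mul_smul_comm, traceNorm_smul (by positivity), traceNorm_tensorPower_fidelity,
      Real.sqrt_mul hp.1.le, Real.sqrt_mul hp']
    have h1 := fidelity_nonneg i.1 j.1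
    have h2 := hF i i.2 j j.2
    calc _ ≤ √p * √(q i) * (√(1 - p) * √(r j)) * F ^ n := by gcongr
      _ = _ := by ring
  have hcs : ∀ {κ : Type _} [Fintype κ] (v : κ → ℝ), (∀ k, 0 ≤ v k) → ∑ k, v k = 1 →
      ∑ k, √(v k) ≤ √(Fintype.card κ) := fun v hv hv1 => by
    have := Real.sum_mul_le_sqrt_mul_sqrt Finset.univ (fun _ => 1) fun k => √(v k)
    simpa [Real.sq_sqrt (hv _), hv1] using this
  calc _ ≤ ∑ i, ∑ j, √(q i) * (√(r j) * (√p * √(1 - p) * F ^ n)) :=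
        Finset.sum_le_sum fun i _ => Finset.sum_le_sum fun j _ => hterm i j
    _ = (∑ i, √(q i)) * ((∑ j, √(r j)) * (√p * √(1 - p) * F ^ n)) := by
        simp only [← Finset.mul_sum, ← Finset.sum_mul]
    _ ≤ √(Fintype.card D₁) * (√(Fintype.card D₂) * (√p * √(1 - p) * F ^ n)) := by
        gcongr
        · exact hcs q hq hq1
        · exact hcs r hr hr1
    _ = _ := by
        rw [Real.sqrt_mul (by positivity [hp.1]), Real.sqrt_mul (by positivity),
          Real.sqrt_mul (by positivity)]
        ring

theorem minError_le {m₁ m₂ : ℕ} {p : ℝ} (hp : p ∈ Set.Ioo (0 : ℝ) 1) (h₁ : D₁.encard = m₁)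
    (h₂ : D₂.encard = m₂) (hn₁ : D₁.Nonempty) (hn₂ : D₂.Nonempty) (n : ℕ) :
    minError n p D₁ D₂ ≤ √(m₁ * m₂ * p * (1 - p)) * maxFidelity D₁ D₂ ^ n := by
  have hf₁ : D₁.Finite := Set.finite_of_encard_eq_coe h₁
  have hf₂ : D₂.Finite := Set.finite_of_encard_eq_coe h₂
  have := hf₁.fintype
  have := hf₂.fintype
  obtain ⟨ρ₀, hρ₀⟩ := hn₁
  obtain ⟨σ₀, hσ₀⟩ := hn₂
  have hF := fun ρ (hρ : ρ ∈ D₁) σ (hσ : σ ∈ D₂) => fidelity_le_maxFidelity hf₁ hf₂ hρ hσ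
  have hF0 := (fidelity_nonneg ρ₀ σ₀).trans (hF _ hρ₀ _ hσ₀)
  have hc₁ : Fintype.card D₁ = m₁ := by
    rw [Set.encard_eq_coe_toFinset_card, Set.toFinset_card] at h₁; exact_mod_cast h₁
  have hc₂ : Fintype.card D₂ = m₂ := by
    rw [Set.encard_eq_coe_toFinset_card, Set.toFinset_card] at h₂; exact_mod_cast h₂
  -- The minimax lemma is strict, so it is applied at every level `c` above the bound.
  refine le_of_forall_gt_imp_ge_of_dense fun c hc => ?_
  obtain ⟨T, hT, hlt⟩ := exists_forall_lt_of_stdSimplex (κ := D₁ × D₂)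
    (fun k => convexOn_simpleError p (tensorPower n k.1.1.1) (tensorPower n k.2.1.1))
    convex_tests ⟨0, zero_mem_tests⟩ (c := c) fun w hw => by
      obtain ⟨T, hT, hle⟩ := exists_test_sum_simpleError_le hp hF hF0 n hw
      rw [hc₁, hc₂] at hle
      exact ⟨T, hT, hle.trans_lt hc⟩
  have hb : BddBelow ((fun T => compositeError n T p D₁ D₂) '' tests (Fin n → Fin d)) := by
    refine ⟨0, ?_⟩
    rintro _ ⟨T, hT, rfl⟩
    exact (simpleError_nonneg hp hT (tensorPower_posSemidef n ρ₀.2.1)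
      (tensorPower_posSemidef n σ₀.2.1)).trans (simpleError_le_compositeError hf₁ hf₂ hρ₀ hσ₀)
  refine (csInf_le hb (Set.mem_image_of_mem _ hT)).trans ?_
  refine csSup_le (Set.Nonempty.image2 ⟨ρ₀, hρ₀⟩ ⟨σ₀, hσ₀⟩) ?_
  rintro _ ⟨ρ, hρ, σ, hσ, rfl⟩
  exact (hlt (⟨ρ, hρ⟩, ⟨σ, hσ⟩)).le

theorem le_of_minError_le {p δ : ℝ} (hp : p ∈ Set.Ioo (0 : ℝ) 1) (h₁ : D₁.Finite)
    (h₂ : D₂.Finite) (hn₁ : D₁.Nonempty) (hn₂ : D₂.Nonempty) {n : ℕ} (hδ : δ ≤ 1 / 2)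
    (h : minError n p D₁ D₂ ≤ δ) :
    p * (1 - p) * (maxFidelity D₁ D₂ ^ n) ^ 2 ≤ δ * (1 - δ) := by
  obtain ⟨ρ, hρ, σ, hσ, hF⟩ := exists_fidelity_eq_maxFidelity h₁ h₂ hn₁ hn₂
  set t := p * (1 - p) * (maxFidelity D₁ D₂ ^ n) ^ 2 with ht
  have key : ∀ T ∈ tests (Fin n → Fin d),
      t ≤ simpleError T p (tensorPower n ρ.1) (tensorPower n σ.1) *
        (1 - simpleError T p (tensorPower n ρ.1) (tensorPower n σ.1)) := fun T hT => by
    have := sq_traceNorm_le_simpleError hp hT (tensorPower_posSemidef n ρ.2.1)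
      (tensorPower_posSemidef n σ.2.1) (tensorPower_trace_eq_one n ρ)
      (tensorPower_trace_eq_one n σ)
    rwa [traceNorm_tensorPower_fidelity, hF] at this
  -- The smaller root of `e (1 - e) = t` bounds every test's error uniformly, so it survives the
  -- infimum; `δ ≤ 1/2` later permits squaring back.
  have hlow : (1 - √(1 - 4 * t)) / 2 ≤ minError n p D₁ D₂ := by
    refine le_csInf (Set.Nonempty.image _ ⟨0, zero_mem_tests⟩) ?_
    rintro _ ⟨T, hT, rfl⟩
    refine le_trans ?_ (simpleError_le_compositeError h₁ h₂ hρ hσ)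
    have h3 := key T hT
    set e := simpleError T p (tensorPower n ρ.1) (tensorPower n σ.1)
    have h4 : |1 - 2 * e| ≤ √(1 - 4 * t) := Real.abs_le_sqrt (by nlinarith)
    have := (le_abs_self _).trans h4
    linarith
  have h5 : 0 ≤ 1 - 4 * t := by
    have h3 := key 0 zero_mem_tests
    set e := simpleError 0 p (tensorPower n ρ.1) (tensorPower n σ.1)
    nlinarith [sq_nonneg (1 - 2 * e)]
  have h6 : 1 - 2 * δ ≤ √(1 - 4 * t) := by linarith
  have h7 : (1 - 2 * δ) ^ 2 ≤ 1 - 4 * t := by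
    have := pow_le_pow_left₀ (by linarith) h6 2
    rwa [Real.sq_sqrt h5] at this
  nlinarith

/-- Finiteness makes the supremum attained, so strictness for each pair passes to the maximum. -/
theorem maxFidelity_mem_Ioo (h₁ : D₁.Finite) (h₂ : D₂.Finite) (hd : Disjoint D₁ D₂)
    (ho : ¬ Orthogonal D₁ D₂) : D₁.Nonempty ∧ D₂.Nonempty ∧
      maxFidelity D₁ D₂ ∈ Set.Ioo (0 : ℝ) 1 := by
  simp only [Orthogonal, not_forall] at ho
  obtain ⟨ρ, hρ, σ, hσ, h⟩ := ho
  refine ⟨⟨ρ, hρ⟩, ⟨σ, hσ⟩, (fidelity_pos ρ σ h).trans_le (fidelity_le_maxFidelity h₁ h₂ hρ hσ), ?_⟩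
  obtain ⟨ρ', hρ', σ', hσ', hF⟩ := exists_fidelity_eq_maxFidelity h₁ h₂ ⟨ρ, hρ⟩ ⟨σ, hσ⟩
  rw [← hF]
  refine fidelity_lt_one ρ' σ' fun he => ?_
  exact Set.disjoint_left.1 hd hρ' (he ▸ hσ')

theorem sampleComplexity_le {p δ : ℝ} {n : ℕ} (hn : 1 ≤ n) (h : minError n p D₁ D₂ ≤ δ) :
    sampleComplexity p D₁ D₂ δ ≤ n :=
  iInf₂_le (f := fun (n : ℕ) (_ : n ∈ {n : ℕ | 1 ≤ n ∧ minError n p D₁ D₂ ≤ δ}) => (n : ℕ∞))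
    n ⟨hn, h⟩

theorem le_sampleComplexity {p δ : ℝ} {k : ℕ∞}
    (h : ∀ n : ℕ, 1 ≤ n → minError n p D₁ D₂ ≤ δ → k ≤ n) : k ≤ sampleComplexity p D₁ D₂ δ :=
  le_iInf₂ fun n hn => h n hn.1 hn.2

/-- A geometric sequence `a * F ^ n` falls below `δ` after `⌈ln (a / δ) / (-ln F)⌉` steps. -/
theorem mul_pow_ceil_log_div_le {a δ F : ℝ} (ha : 0 < a) (hδ : 0 < δ)
    (hF : F ∈ Set.Ioo (0 : ℝ) 1) :
    a * F ^ ⌈Real.log (a / δ) / (-Real.log F)⌉₊ ≤ δ := by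
  have hl : 0 < -Real.log F := neg_pos.2 (Real.log_neg hF.1 hF.2)
  have h := (div_le_iff₀ hl).1 (Nat.le_ceil (Real.log (a / δ) / (-Real.log F)))
  set n := ⌈Real.log (a / δ) / (-Real.log F)⌉₊
  have hpos : 0 < a * F ^ n := mul_pos ha (pow_pos hF.1 n)
  rw [← Real.log_le_log_iff hpos hδ, Real.log_mul ha.ne' (pow_pos hF.1 n).ne', Real.log_pow]
  rw [Real.log_div ha.ne' hδ.ne'] at h
  linarith

end QHT

/-! ### The sample complexity bounds. -/

theorem mainTheorem1 (p : ℝ) (hp : p ∈ Set.Ioo (0 : ℝ) 1) :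
    -- the explicit upper bound, and the remaining values of `δ`, for which one copy suffices
    (∀ (d m₁ m₂ : ℕ) (D₁ D₂ : Set (QHT.DensityMatrix d)),
      D₁.encard = m₁ → D₂.encard = m₂ → Disjoint D₁ D₂ → ¬ QHT.Orthogonal D₁ D₂ →
      ∀ δ ∈ Set.Ioo (0 : ℝ) 1,
        (δ < √(m₁ * m₂ * p * (1 - p)) →
          QHT.sampleComplexity p D₁ D₂ δ ≤
            (⌈Real.log (√(m₁ * m₂ * p * (1 - p)) / δ) /
              (-Real.log (QHT.maxFidelity D₁ D₂))⌉₊ : ℕ∞)) ∧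
        (√(m₁ * m₂ * p * (1 - p)) ≤ δ → QHT.sampleComplexity p D₁ D₂ δ = 1)) ∧
    -- the lower bound `Ω(ln(1/δ) / (-ln F_max))`
    (∀ δ₀ ∈ Set.Ioo (0 : ℝ) (min p (1 - p)), ∃ c : ℝ, 0 < c ∧
      ∀ (d m₁ m₂ : ℕ) (D₁ D₂ : Set (QHT.DensityMatrix d)),
        D₁.encard = m₁ → D₂.encard = m₂ → Disjoint D₁ D₂ → ¬ QHT.Orthogonal D₁ D₂ →
        ∀ δ ∈ Set.Ioc (0 : ℝ) δ₀,
          ENNReal.ofReal (c * (Real.log (1 / δ) / (-Real.log (QHT.maxFidelity D₁ D₂)))) ≤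
            (QHT.sampleComplexity p D₁ D₂ δ : ENNReal)) ∧
    -- the upper bound `O(ln(√(m₁ m₂)/δ) / (-ln F_max))`
    (∃ C : ℝ, 0 < C ∧
      ∀ (d m₁ m₂ : ℕ) (D₁ D₂ : Set (QHT.DensityMatrix d)),
        D₁.encard = m₁ → D₂.encard = m₂ → Disjoint D₁ D₂ → ¬ QHT.Orthogonal D₁ D₂ →
        ∀ δ ∈ Set.Ioo (0 : ℝ) 1, δ ≤ √(m₁ * m₂) * QHT.maxFidelity D₁ D₂ →
          (QHT.sampleComplexity p D₁ D₂ δ : ENNReal) ≤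
            ENNReal.ofReal (C * (Real.log (√(m₁ * m₂) / δ) /
              (-Real.log (QHT.maxFidelity D₁ D₂))))) := by
  have hp' : 0 < 1 - p := sub_pos.2 hp.2
  have hp0 := hp.1
  refine ⟨fun d m₁ m₂ D₁ D₂ h₁ h₂ hd ho δ hδ => ?_, fun δ₀ hδ₀ => ?_, 2, two_pos,
    fun d m₁ m₂ D₁ D₂ h₁ h₂ hd ho δ hδ hδF => ?_⟩
  · obtain ⟨hn₁, hn₂, hF⟩ := QHT.maxFidelity_mem_Ioo (Set.finite_of_encard_eq_coe h₁)
      (Set.finite_of_encard_eq_coe h₂) hd ho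
    have hle := QHT.minError_le hp h₁ h₂ hn₁ hn₂
    set F := QHT.maxFidelity D₁ D₂
    have hl : 0 < -Real.log F := neg_pos.2 (Real.log_neg hF.1 hF.2)
    refine ⟨fun hlt => ?_, fun hge => le_antisymm ?_ ?_⟩
    · refine QHT.sampleComplexity_le ?_ ((hle _).trans
        (QHT.mul_pow_ceil_log_div_le (hδ.1.trans hlt) hδ.1 hF))
      exact Nat.one_le_ceil_iff.2 (div_pos (Real.log_pos ((one_lt_div hδ.1).2 hlt)) hl)
    · have := QHT.sampleComplexity_le (D₁ := D₁) (D₂ := D₂) (p := p) (δ := δ) le_rfl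
        ((hle 1).trans ?_)
      · exact_mod_cast this
      · rw [pow_one]
        exact (mul_le_of_le_one_right (Real.sqrt_nonneg _) hF.2.le).trans hge
    · exact QHT.le_sampleComplexity fun n hn _ => by exact_mod_cast hn
  · obtain ⟨h0, hlt⟩ := hδ₀
    obtain ⟨hlt1, hlt2⟩ := lt_min_iff.1 hlt
    have hpp : 0 < p * (1 - p) := mul_pos hp0 hp'
    -- The difference factors as `(p - δ₀) (1 - p - δ₀)`.
    have hq : δ₀ * (1 - δ₀) < p * (1 - p) := by
      nlinarith [mul_pos (sub_pos.2 hlt1) (sub_pos.2 hlt2)]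
    set K := Real.log (p * (1 - p)) - Real.log (δ₀ * (1 - δ₀)) with hKdef
    set B := -Real.log (p * (1 - p)) with hBdef
    have hK : 0 < K := sub_pos.2 (Real.log_lt_log (mul_pos h0 (by linarith)) hq)
    have hB : 0 < B := neg_pos.2 (Real.log_neg hpp (by nlinarith))
    -- Below, `L ≥ K` and `L ≥ ln (1/δ) - B`; weighting these by `B` and `K` gives `(K + B) L ≥ K ln
    -- (1/δ)`. The `1/2` comes from the squared fidelity.
    refine ⟨K / (K + B) / 2, by positivity, fun d m₁ m₂ D₁ D₂ h₁ h₂ hd ho δ hδ => ?_⟩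
    have hf₁ := Set.finite_of_encard_eq_coe h₁
    have hf₂ := Set.finite_of_encard_eq_coe h₂
    obtain ⟨hn₁, hn₂, hF⟩ := QHT.maxFidelity_mem_Ioo hf₁ hf₂ hd ho
    have hl : 0 < -Real.log (QHT.maxFidelity D₁ D₂) := neg_pos.2 (Real.log_neg hF.1 hF.2)
    set x := K / (K + B) / 2 * (Real.log (1 / δ) / (-Real.log (QHT.maxFidelity D₁ D₂))) with hx
    have hceil : ((⌈x⌉₊ : ℕ) : ℕ∞) ≤ QHT.sampleComplexity p D₁ D₂ δ := by
      refine QHT.le_sampleComplexity fun n hn hmin => ?_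
      rw [Nat.cast_le, Nat.ceil_le]
      have hmain := QHT.le_of_minError_le hp hf₁ hf₂ hn₁ hn₂ (by linarith [hδ.2]) hmin
      set F := QHT.maxFidelity D₁ D₂
      have hδ1 : 0 < 1 - δ := by linarith [hδ.2]
      have hFn : 0 < (F ^ n) ^ 2 := by have := hF.1; positivity
      have hlog := Real.log_le_log (mul_pos hpp hFn) hmain
      rw [Real.log_mul hpp.ne' hFn.ne', Real.log_pow, Real.log_pow] at hlog
      have hL1 : Real.log (δ * (1 - δ)) ≤ Real.log (δ₀ * (1 - δ₀)) :=
        Real.log_le_log (mul_pos hδ.1 hδ1) (by nlinarith [hδ.2])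
      have hL2 : Real.log (δ * (1 - δ)) ≤ Real.log δ :=
        Real.log_le_log (mul_pos hδ.1 hδ1) (by nlinarith [hδ.1])
      have hd' : Real.log (1 / δ) = -Real.log δ := by rw [one_div, Real.log_inv]
      set L := Real.log (p * (1 - p)) - Real.log (δ * (1 - δ)) with hLdef
      have hKL : K ≤ L := by linarith
      have hLB : Real.log (1 / δ) - B ≤ L := by rw [hd']; linarith
      have hL : L ≤ 2 * (n * -Real.log F) := by push_cast at hlog; linarith
      have h1 : K * Real.log (1 / δ) ≤ (K + B) * L := by nlinarith
      have h2 : K / (K + B) * Real.log (1 / δ) ≤ L := by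
        rw [div_mul_eq_mul_div, div_le_iff₀ (by positivity)]
        linarith
      rw [hx, ← mul_div_assoc, div_le_iff₀ hl]
      linarith
    calc ENNReal.ofReal x ≤ ENNReal.ofReal (⌈x⌉₊ : ℝ) := ENNReal.ofReal_le_ofReal (Nat.le_ceil x)
      _ = (((⌈x⌉₊ : ℕ) : ℕ∞) : ENNReal) := by rw [ENNReal.ofReal_natCast]; rfl
      _ ≤ _ := ENat.toENNReal_le.2 hceil
  · obtain ⟨hn₁, hn₂, hF⟩ := QHT.maxFidelity_mem_Ioo (Set.finite_of_encard_eq_coe h₁)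
      (Set.finite_of_encard_eq_coe h₂) hd ho
    have hle := QHT.minError_le hp h₁ h₂ hn₁ hn₂
    set F := QHT.maxFidelity D₁ D₂
    have hl : 0 < -Real.log F := neg_pos.2 (Real.log_neg hF.1 hF.2)
    set M := √((m₁ : ℝ) * m₂)
    have hM : 0 < M := pos_of_mul_pos_left (hδ.1.trans_le hδF) hF.1.le
    set y := Real.log (M / δ) / (-Real.log F)
    -- This is what makes `C = 2` suffice: `⌈y⌉ < y + 1 ≤ 2 y`.
    have hy : 1 ≤ y := by
      rw [le_div_iff₀ hl, one_mul, ← Real.log_inv]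
      refine Real.log_le_log (inv_pos.2 hF.1) ?_
      rw [le_div_iff₀ hδ.1, inv_mul_le_iff₀ hF.1, mul_comm]
      exact hδF
    have hsq : √(m₁ * m₂ * p * (1 - p)) ≤ M := by
      refine Real.sqrt_le_sqrt ?_
      rw [mul_assoc]
      exact mul_le_of_le_one_right (by positivity) (by nlinarith)
    have hn : QHT.sampleComplexity p D₁ D₂ δ ≤ (⌈y⌉₊ : ℕ) := by
      refine QHT.sampleComplexity_le (Nat.one_le_ceil_iff.2 (by linarith)) ((hle _).trans ?_)
      refine le_trans ?_ (QHT.mul_pow_ceil_log_div_le hM hδ.1 hF)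
      have := hF.1
      gcongr
    calc (QHT.sampleComplexity p D₁ D₂ δ : ENNReal) ≤ (((⌈y⌉₊ : ℕ) : ℕ∞) : ENNReal) :=
          ENat.toENNReal_le.2 hn
      _ = ENNReal.ofReal (⌈y⌉₊ : ℝ) := by rw [ENNReal.ofReal_natCast]; rfl
      _ ≤ ENNReal.ofReal (2 * y) := ENNReal.ofReal_le_ofReal (by
          linarith [Nat.ceil_lt_add_one (by linarith : 0 ≤ y)])
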